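/- A path is a finite walk on the square grid starting at $(0,0)$ with unit steps north ($N$) and east ($E$). Let $v$ be any path. **The poset $\mathrm{Tam}(v)$.** Its elements are the paths $u$ from $(0,0)$ to the end of $v$ that are weakly above $v$. For an integer point $p$ of such a $u$, let $\mathrm{horiz}_v(p)$ be the maximum number of east steps that can be added to the right of $p$ without crossing $v$. Suppose that $p$ is preceded by an east step $E$ and followed by a north step in $u$, let $p'$ be the first point of $u$ after $p$ with $\mathrm{horiz}_v(p')=\mathrm{horiz}_v(p)$, and let $D$ be the part of $u$ from $p$ to $p'$. If $u'$ is obtained from $u$ by exchanging $E$ and $D$ (so $u=P\,E\,D\,S$ and $u'=P\,D\,E\,S$), write $u<_v u'$. The order of $\mathrm{Tam}(v)$ is the reflexive transitive closure of $<_v$. **The poset $I(v)$.** A complete binary tree $\overline T$ is a binary tree all of whose vertices have $0$ (external vertices) or $2$ (internal vertices) children; deleting its external vertices gives a binary tree $T$. We only consider $\overline T$ with at least one internal vertex. Walk around $T$ starting at the root, left subtrees first, and write $a$, $\bar a$ for the first and the second passage along a left edge, and $b$, $\bar b$ for the first and the second passage along a right edge. Keeping only $\bar a$ (read as $N$) and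 $\bar b$ (read as $E$) gives the path $u(T)$; keeping only $\bar a$ (read as $N$) and $b$ (read as $E$) gives the path $v(T)$, the interior canopy of $\overline T$. A right rotation replaces, at an internal vertex, the subtree $((A,B),C)$ by $(A,(B,C))$, where $A,B,C$ are complete binary trees; it is valid if $B$ has more than one vertex. The Tamari order is the reflexive transitive closure of right rotation, and $I(v)$ is the set of complete binary trees with interior canopy $v$, with the restriction of the Tamari order. **Proposition.** For any path $v$, the map $\overline T\mapsto u(T)$ is an isomorphism of posets from $I(v)$ to $\mathrm{Tam}(v)$. Moreover: 1. For every $\overline T\in I(v)$ and every complete binary tree $\overline S$, $\overline S$ is obtained from $\overline T$ by a valid right rotation if and only if $\overline S\in I(v)$ and $u(T)<_v u(S)$. 2. For $u,u'\in\mathrm{Tam}(v)$, $u'$ covers $u$ in the poset $\mathrm{Tam}(v)$ if and only if $u<_v u'$. 3. For every $\overline T\in I(v)$, the sequence of right heights of the vertices of $T$ in post-order (the right height of a vertex is the number of right edges on the walk from the root to it) equals the sequence of values $\mathrm{horiz}_v(p)$ for the consecutive integer points $p$ of $u(T)$ from $(0,0)$ to the end. -/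

import Mathlib

/-! ### Paths on the square grid and the poset of paths weakly above `v` -/

/-- A unit step on the square grid: north or east. -/
inductive GridStep where
  | N : GridStep
  | E : GridStep
  deriving DecidableEq

/-- A path is a finite walk starting at `(0,0)` with north and east unit steps. -/
abbrev GridPath := List GridStep

namespace GridPath

open GridStep

/-- The point `(x, y)` where a path ends. -/
def endpoint (u : GridPath) : ℕ × ℕ := (u.count E, u.count N)

/-- The consecutive integer points on a path, from `(0,0)` to the end (a path with `m` steps
has `m + 1` of them). -/
def points (u : GridPath) : List (ℕ × ℕ) := u.inits.map endpoint

/-- The point `p` is weakly above `v`: at the height of `p`, some point of `v` is at `p` or to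
the right of `p`. -/
def PointAbove (v : GridPath) (p : ℕ × ℕ) : Prop :=
  ∃ q ∈ points v, q.2 = p.2 ∧ p.1 ≤ q.1

/-- The path `u` is weakly above the path `v`, and has the same end. -/
def IsAbove (v u : GridPath) : Prop :=
  endpoint u = endpoint v ∧ ∀ p ∈ points u, PointAbove v p

/-- The horizontal distance of `p`: the maximum number of east steps that can be added to the
right of `p` without crossing `v`. -/
noncomputable def horiz (v : GridPath) (p : ℕ × ℕ) : ℕ :=
  sSup {k : ℕ | ∀ j ≤ k, PointAbove v (p.1 + j, p.2)}

/-- The elementary relation `u <_v u'`. Here `u = P E D S`, the point `p` is the end of `P E`,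
the step of `u` after `p` is a north step, `D` is the part of `u` from `p` to the first later
point `p'` of `u` with the same horizontal distance as `p`, and `u' = P D E S`. -/
def TamStep (v u u' : GridPath) : Prop :=
  ∃ P D S : GridPath,
    u = P ++ [E] ++ D ++ S ∧
    u' = P ++ D ++ [E] ++ S ∧
    D.head? = some N ∧
    horiz v (endpoint (P ++ [E] ++ D)) = horiz v (endpoint (P ++ [E])) ∧
    ∀ D' : GridPath, D' <+: D → D' ≠ [] → D' ≠ D →
      horiz v (endpoint (P ++ [E] ++ D')) ≠ horiz v (endpoint (P ++ [E]))

/-- Auxiliary statistic for antisymmetry: the number of pairs formed by an east step and a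
later north step. -/
def inv : GridPath → ℕ
  | [] => 0
  | E :: l => l.count N + inv l
  | N :: l => inv l

theorem inv_append (l m : GridPath) : inv (l ++ m) = inv l + inv m + l.count E * m.count N := by
  induction l with
  | nil => simp [inv]
  | cons a l ih => cases a <;> simp [inv, ih] <;> ring

theorem TamStep.inv_lt {v u u' : GridPath} (h : TamStep v u u') : inv u' < inv u := by
  obtain ⟨P, D, S, rfl, rfl, hD, -, -⟩ := h
  have : 0 < D.count N := by
    cases D with
    | nil => simp at hD
    | cons a D => simp at hD; subst hD; simp
  simp only [inv_append, List.count_append]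
  simp [inv]
  nlinarith

end GridPath

/-- The set of paths underlying `Tam(v)`: the paths weakly above `v` that start at `(0,0)` and
finish at the end of `v`. -/
def Tam (v : GridPath) : Type := {u : GridPath // GridPath.IsAbove v u}

/-- The order of `Tam(v)` is the reflexive transitive closure of the elementary relation. -/
instance Tam.instPartialOrder (v : GridPath) : PartialOrder (Tam v) where
  le := Relation.ReflTransGen fun u u' => GridPath.TamStep v u.1 u'.1
  le_refl _ := Relation.ReflTransGen.refl
  le_trans _ _ _ := Relation.ReflTransGen.trans
  le_antisymm a b hab hba := by
    have key : ∀ x y : Tam v,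
        Relation.ReflTransGen (fun u u' : Tam v => GridPath.TamStep v u.1 u'.1) x y →
        GridPath.inv y.1 ≤ GridPath.inv x.1 := by
      intro x y h
      induction h with
      | refl => exact le_rfl
      | tail _ h ih => exact (h.inv_lt.le).trans ih
    rcases Relation.ReflTransGen.cases_head hab with h | ⟨c, hc, hcb⟩
    · exact h
    · exact absurd (hc.inv_lt.trans_le (key _ _ hba)) (not_lt.mpr (key _ _ hcb))

/-! ### Binary trees

A term of `BinaryTree Unit` is read in two ways. As a binary tree `T`, `nil` is the empty tree
and `node () L R` is the triple `(L, r, R)`. As a complete binary tree `T̄`, `nil` is an external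
vertex and each `node` is an internal vertex with its two children. Deleting the external
vertices of `T̄` gives `T`, so that both readings are of the same term. -/

namespace CanopyTree

open BinaryTree

/-- The letters `a`, `ā`, `b`, `b̄` of the word of a binary tree: first and second passage
along a left edge, first and second passage along a right edge. -/
inductive Letter where
  | a : Letter
  | aBar : Letter
  | b : Letter
  | bBar : Letter
  deriving DecidableEq

/-- The word `w(T)` read while walking around `T` from the root, left subtree first. -/
def word : BinaryTree Unit → List Letter
  | nil => []
  | node _ L R =>
      (if L = nil then [] else [Letter.a] ++ word L ++ [Letter.aBar]) ++
      (if R = nil then [] else [Letter.b] ++ word R ++ [Letter.bBar])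

/-- The path `u(T)`: keep `ā` (as a north step) and `b̄` (as an east step). -/
def upperPath (T : BinaryTree Unit) : GridPath :=
  (word T).filterMap fun
    | Letter.aBar => some GridStep.N
    | Letter.bBar => some GridStep.E
    | _ => none

/-- The canopy `v(T)`: keep `ā` (as a north step) and `b` (as an east step). It is the interior
canopy of the complete binary tree `T̄`. -/
def canopy (T : BinaryTree Unit) : GridPath :=
  (word T).filterMap fun
    | Letter.aBar => some GridStep.N
    | Letter.b => some GridStep.E
    | _ => none

/-- The right heights of the vertices of `T` in post order, when the root has right height
`h`. -/
def rightHeightsFrom : ℕ → BinaryTree Unit → List ℕ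
  | _, nil => []
  | h, node _ L R => rightHeightsFrom h L ++ rightHeightsFrom (h + 1) R ++ [h]

/-- The right heights (numbers of right edges on the walk from the root) of the vertices of `T`
in post order. -/
def rightHeights (T : BinaryTree Unit) : List ℕ := rightHeightsFrom 0 T

/-- `RightRotation T T'`: the complete binary tree `T'` is obtained from `T` by one right
rotation, at any internal vertex `s` whose left child `t` is internal. -/
inductive RightRotation : BinaryTree Unit → BinaryTree Unit → Prop
  | root (A B C : BinaryTree Unit) :
      RightRotation (node () (node () A B) C) (node () A (node () B C))
  | left {L L' : BinaryTree Unit} (R : BinaryTree Unit) :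
      RightRotation L L' → RightRotation (node () L R) (node () L' R)
  | right (L : BinaryTree Unit) {R R' : BinaryTree Unit} :
      RightRotation R R' → RightRotation (node () L R) (node () L R')

/-- `ValidRightRotation T T'`: the same, where moreover the rotation is valid, that is, the
complete binary tree `B` has more than one vertex (it is not a single external vertex). -/
inductive ValidRightRotation : BinaryTree Unit → BinaryTree Unit → Prop
  | root (A B C : BinaryTree Unit) (hB : B ≠ nil) :
      ValidRightRotation (node () (node () A B) C) (node () A (node () B C))
  | left {L L' : BinaryTree Unit} (R : BinaryTree Unit) :
      ValidRightRotation L L' → ValidRightRotation (node () L R) (node () L' R)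
  | right (L : BinaryTree Unit) {R R' : BinaryTree Unit} :
      ValidRightRotation R R' → ValidRightRotation (node () L R) (node () L R')

/-- The Tamari order on complete binary trees: the reflexive transitive closure of right
rotation. -/
def TamariLE : BinaryTree Unit → BinaryTree Unit → Prop := Relation.ReflTransGen RightRotation

/-- Auxiliary statistic for antisymmetry: the sum over all vertices of the size of the right
subtree. -/
def rightWeight : BinaryTree Unit → ℕ
  | nil => 0
  | node _ L R => rightWeight L + rightWeight R + R.numNodes

theorem RightRotation.numNodes_eq {T T' : BinaryTree Unit} (h : RightRotation T T') :
    T'.numNodes = T.numNodes := by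
  induction h with
  | root A B C => simp; ring
  | left R _ ih => simp [ih]
  | right L _ ih => simp [ih]

theorem RightRotation.rightWeight_lt {T T' : BinaryTree Unit} (h : RightRotation T T') :
    rightWeight T < rightWeight T' := by
  induction h with
  | root A B C => simp [rightWeight]; omega
  | left R _ ih => simp [rightWeight, ih]
  | right L h ih => simp [rightWeight, ih, h.numNodes_eq]

theorem TamariLE.rightWeight_le {T T' : BinaryTree Unit} (h : TamariLE T T') :
    rightWeight T ≤ rightWeight T' := by
  induction h with
  | refl => exact le_rfl
  | tail _ h ih => exact ih.trans h.rightWeight_lt.le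

theorem TamariLE.antisymm {T T' : BinaryTree Unit} (h : TamariLE T T') (h' : TamariLE T' T) :
    T = T' := by
  rcases Relation.ReflTransGen.cases_head h with h | ⟨c, hc, hcb⟩
  · exact h
  · have h1 := hc.rightWeight_lt
    have h2 := TamariLE.rightWeight_le hcb
    have h3 := h'.rightWeight_le
    omega

/-- The complete binary tree `T` has at least one internal vertex and its interior canopy
is `v`. -/
def HasCanopy (v : GridPath) (T : BinaryTree Unit) : Prop := T ≠ nil ∧ canopy T = v

end CanopyTree

/-- The set underlying `I(v)`: the complete binary trees with interior canopy `v`. -/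
def CanopyInterval (v : GridPath) : Type := {T : BinaryTree Unit // CanopyTree.HasCanopy v T}

/-- The order of `I(v)` is the restriction of the Tamari order. -/
instance CanopyInterval.instPartialOrder (v : GridPath) : PartialOrder (CanopyInterval v) where
  le T T' := CanopyTree.TamariLE T.1 T'.1
  le_refl _ := Relation.ReflTransGen.refl
  le_trans _ _ _ := Relation.ReflTransGen.trans
  le_antisymm _ _ h h' := Subtype.ext (h.antisymm h')

/-!
The key fact is that the right heights of `T` in post-order are the horizontal distances along
`u(T)`. The vertex number `i` in post-order (from `0`) corresponds to the prefix of `u(T)` of length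
`i`, and by induction on `T` the end of this prefix lies as many east steps left of the end of its
row in `v(T)` as there are right edges above the vertex. A tree can be recovered from its right
heights, so `u` is injective on `I(v)`; removing the first step of a path weakly above `v` is
matched by the insertion of a first step into a tree, so `u` is onto `Tam(v)`.

A valley `E N` of `u(T)` is a vertex whose left child has a nonempty right subtree, that is, a place
for a valid rotation `((A, B), C) ↦ (A, (B, C))`. The point between `E` and `N` corresponds to the
left child, of right height `c` say; the next right heights are those of the vertices of `C`, all
larger than `c`, and then `c` again, that of the rotated vertex. So the first return to distance `c`
ends `D = N u(C) E` (or `D = N` if `C` is empty), and the rotation moves `E` behind it.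

An invalid rotation loses a north step of the canopy and a valid one keeps the canopy, so chains of
rotations inside `I(v)` consist of valid ones. The sizes of the right subtrees, listed in symmetric
order, increase weakly along the Tamari order, and a rotation changes exactly one of them, its
position determining the new value. So no rotation factors through a different one.
-/

theorem eq_of_concat_prefix_of_ne {α : Type*} {a b : α} (hab : a ≠ b) {l m s t : List α}
    (hls : l ++ [a] <+: s) (hlt : l ++ [b] <+: t) (hms : m ++ [a] <+: s) (hmt : m ++ [b] <+: t) :
    l = m := by
  have length_le : ∀ {l m : List α}, l ++ [a] <+: s → l ++ [b] <+: t → m ++ [a] <+: s →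
      m ++ [b] <+: t → m.length ≤ l.length := by
    intro l m hls hlt hms hmt
    by_contra! hlen
    have hlm : l ++ [a] <+: m :=
      List.prefix_of_prefix_length_le hls ((List.prefix_append m [a]).trans hms) (by simpa)
    have hlt' : l ++ [a] <+: t := hlm.trans ((List.prefix_append m [b]).trans hmt)
    exact hab (by simpa using List.prefix_of_prefix_length_le hlt' hlt (by simp))
  refine (List.prefix_of_prefix_length_le ((List.prefix_append l [a]).trans hls)
    ((List.prefix_append m [a]).trans hms) (length_le hms hmt hls hlt)).eq_of_length ?_
  exact le_antisymm (length_le hms hmt hls hlt) (length_le hls hlt hms hmt)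

theorem append_cons_inj_of_notMem_right {α : Type*} {a : α} {x₁ x₂ z₁ z₂ : List α} (h₁ : a ∉ z₁)
    (h₂ : a ∉ z₂) (h : x₁ ++ a :: z₁ = x₂ ++ a :: z₂) : x₁ = x₂ ∧ z₁ = z₂ := by
  rcases List.append_eq_append_iff.1 h with ⟨_ | ⟨b, c⟩, rfl, hz⟩ | ⟨_ | ⟨b, c⟩, rfl, hz⟩ <;>
    simp_all

theorem exists_append_eq_of_replicate_append_eq {α : Type*} {a b : α} (hab : a ≠ b) {k : ℕ}
    {w l r : List α} (h : List.replicate k a ++ w = l ++ b :: r) :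
    ∃ w', l = List.replicate k a ++ w' ∧ w = w' ++ b :: r := by
  rcases List.append_eq_append_iff.1 h with h | ⟨_ | ⟨c, m⟩, hk, hr⟩
  · exact h
  · exact ⟨[], by simpa using hk.symm, by simpa using hr.symm⟩
  · obtain rfl : b = c := (List.cons.inj hr).1
    exact absurd (List.eq_of_mem_replicate (hk ▸ by simp : b ∈ List.replicate k a)).symm hab

namespace GridPath

open GridStep

/-! ### Horizontal distances -/

theorem endpoint_append (l m : GridPath) : endpoint (l ++ m) = endpoint l + endpoint m := by
  simp [endpoint]

theorem pointAbove_iff_exists_prefix_count {v : GridPath} {p : ℕ × ℕ} :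
    PointAbove v p ↔ ∃ l, l <+: v ∧ l.count N = p.2 ∧ p.1 ≤ l.count E := by
  simp [PointAbove, points, endpoint]

/-- The last point of `v` in the row of `p` lies `h` east steps to the right of `p`. Unlike an
equation `horiz v p = h`, this also says that `p` is weakly above `v`. -/
def IsHorizDist (v : GridPath) (p : ℕ × ℕ) (h : ℕ) : Prop :=
  ∃ l w, v = l ++ w ∧ w.head? ≠ some E ∧ endpoint l = (p.1 + h, p.2)

namespace IsHorizDist

variable {v : GridPath} {p : ℕ × ℕ} {h : ℕ}

theorem pointAbove_add_iff (hp : IsHorizDist v p h) (j : ℕ) :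
    PointAbove v (p.1 + j, p.2) ↔ j ≤ h := by
  obtain ⟨l, w, rfl, hw, hl⟩ := hp
  obtain ⟨hlE, hlN⟩ := Prod.mk.inj hl
  rw [pointAbove_iff_exists_prefix_count]
  constructor
  · rintro ⟨m, hm, hmN, hmE⟩
    have hml : m <+: l := by
      rcases List.prefix_or_prefix_of_prefix hm (List.prefix_append l w) with hml | ⟨r, rfl⟩
      · exact hml
      · have hr : r <+: w := (List.prefix_append_right_inj l).1 hm
        rcases r with _ | ⟨_ | _, r⟩
        · simp
        · simp at hmN
          omega
        · obtain ⟨t, rfl⟩ := hr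
          simp at hw
    have := hml.sublist.count_le E
    omega
  · intro hj
    exact ⟨l, List.prefix_append l w, hlN, by omega⟩

theorem pointAbove (hp : IsHorizDist v p h) : PointAbove v p :=
  (hp.pointAbove_add_iff 0).2 h.zero_le

theorem horiz_eq (hp : IsHorizDist v p h) : horiz v p = h := by
  have hset : {k : ℕ | ∀ j ≤ k, PointAbove v (p.1 + j, p.2)} = Set.Iic h := by
    ext k
    simp only [hp.pointAbove_add_iff, Set.mem_ofPred_eq, Set.mem_Iic]
    exact ⟨fun hk => hk k le_rfl, fun hk j hj => hj.trans hk⟩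
  rw [horiz, hset, csSup_Iic]

theorem append_right (hp : IsHorizDist v p h) {w : GridPath} (hw : w.head? ≠ some E) :
    IsHorizDist (v ++ w) p h := by
  obtain ⟨l, r, rfl, hr, hl⟩ := hp
  refine ⟨l, r ++ w, List.append_assoc l r w, ?_, hl⟩
  cases r <;> simp_all

theorem append_left (hp : IsHorizDist v p h) (q : GridPath) :
    IsHorizDist (q ++ v) (endpoint q + p) h := by
  obtain ⟨l, w, rfl, hw, hl⟩ := hp
  exact ⟨q ++ l, w, by simp, hw, by simp [endpoint_append, hl, Prod.ext_iff, add_assoc]⟩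

theorem cons_east (hp : IsHorizDist v p h) : IsHorizDist (E :: v) p (h + 1) := by
  obtain ⟨l, w, rfl, hw, hl⟩ := hp
  refine ⟨E :: l, w, rfl, hw, ?_⟩
  simp_all [endpoint, add_assoc]

end IsHorizDist

theorem isHorizDist_endpoint (v : GridPath) : IsHorizDist v (endpoint v) 0 :=
  ⟨v, [], by simp, by simp, rfl⟩

/-! ### Removing the first step of a path weakly above `v` -/

theorem IsAbove.count_eq {v u : GridPath} (h : IsAbove v u) (s : GridStep) :
    u.count s = v.count s := by
  cases s
  · exact congrArg Prod.snd h.1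
  · exact congrArg Prod.fst h.1

theorem isAbove_iff_forall_prefix_count {v u : GridPath} :
    IsAbove v u ↔ endpoint u = endpoint v ∧
      ∀ p, p <+: u → ∃ l, l <+: v ∧ l.count N = p.count N ∧ p.count E ≤ l.count E := by
  simp [IsAbove, points, pointAbove_iff_exists_prefix_count, endpoint]

theorem IsAbove.eq_nil {v : GridPath} (h : IsAbove v []) : v = [] := by
  cases v with
  | nil => rfl
  | cons s v => simpa using h.count_eq s

theorem IsAbove.exists_eq_cons_east {v u : GridPath} (h : IsAbove v (E :: u)) :
    ∃ v', v = E :: v' ∧ IsAbove v' u := by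
  obtain ⟨hend, hpre⟩ := isAbove_iff_forall_prefix_count.1 h
  obtain ⟨l, ⟨r, rfl⟩, hlN, hlE⟩ := hpre [E] (by simp)
  rcases l with _ | ⟨_ | _, l⟩
  · simp at hlE
  · simp at hlN
  refine ⟨l ++ r, rfl, isAbove_iff_forall_prefix_count.2 ⟨by simpa [endpoint] using hend, ?_⟩⟩
  intro p hp
  obtain ⟨m, hm, hmN, hmE⟩ := hpre (E :: p) (by simpa using hp)
  rcases m with _ | ⟨s, m⟩
  · simp at hmE
  · have hm' : s = E ∧ m <+: l ++ r := by simpa using hm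
    obtain rfl := hm'.1
    exact ⟨m, hm'.2, by simpa using hmN, by simpa using hmE⟩

theorem exists_eq_replicate_east_append {v : GridPath} (h : 0 < v.count N) :
    ∃ k v', v = List.replicate k E ++ N :: v' := by
  induction v with
  | nil => simp at h
  | cons s v ih =>
    cases s with
    | N => exact ⟨0, v, rfl⟩
    | E =>
      obtain ⟨k, v', rfl⟩ := ih (by simpa using h)
      exact ⟨k + 1, v', rfl⟩

theorem IsAbove.exists_eq_of_cons_north {v u : GridPath} (h : IsAbove v (N :: u)) :
    ∃ k v', v = List.replicate k E ++ N :: v' ∧ IsAbove (List.replicate k E ++ v') u := by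
  obtain ⟨k, v', rfl⟩ := exists_eq_replicate_east_append (v := v) (by simp [← h.count_eq])
  obtain ⟨hend, hpre⟩ := isAbove_iff_forall_prefix_count.1 h
  refine ⟨k, v', rfl, isAbove_iff_forall_prefix_count.2 ⟨?_, fun p hp => ?_⟩⟩
  · simpa [endpoint, ← add_assoc] using hend
  obtain ⟨m, hm, hmN, hmE⟩ := hpre (N :: p) (by simpa using hp)
  have hkm : List.replicate k E ++ [N] <+: m := by
    have hk : List.replicate k E ++ [N] <+: List.replicate k E ++ N :: v' := by simp
    rcases List.prefix_or_prefix_of_prefix hm hk with hmk | hkm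
    · rcases List.prefix_concat_iff.1 hmk with rfl | hmk
      · exact List.prefix_rfl
      · have := hmk.sublist.count_le N
        simp [List.count_replicate] at this hmN
        omega
    · exact hkm
  obtain ⟨m, rfl⟩ := hkm
  refine ⟨List.replicate k E ++ m, by simpa using hm, ?_, by simpa using hmE⟩
  simp [List.count_replicate] at hmN ⊢
  omega

/-! ### Uniqueness of the elementary relation at a valley -/

theorem TamStep.exists_valley {v u u' : GridPath} (h : TamStep v u u') :
    ∃ P, P ++ [E, N] <+: u ∧ P ++ [N] <+: u' := by
  obtain ⟨P, D, S, rfl, rfl, hD, -, -⟩ := h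
  obtain ⟨D, rfl⟩ : ∃ D', D = N :: D' := by cases D <;> simp_all
  exact ⟨P, by simp, by simp⟩

theorem TamStep.eq_of_prefix_concat_north {v u u₁ u₂ P : GridPath} (h₁ : TamStep v u u₁)
    (h₂ : TamStep v u u₂) (hP : P ++ [E] <+: u) (hP₁ : P ++ [N] <+: u₁)
    (hP₂ : P ++ [N] <+: u₂) : u₁ = u₂ := by
  obtain ⟨P₁, D₁, S₁, rfl, rfl, hD₁, hret₁, hfirst₁⟩ := h₁
  obtain ⟨P₂, D₂, S₂, hu, rfl, hD₂, hret₂, hfirst₂⟩ := h₂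
  obtain ⟨D₁, rfl⟩ : ∃ D', D₁ = N :: D' := by cases D₁ <;> simp_all
  obtain ⟨D₂, rfl⟩ : ∃ D', D₂ = N :: D' := by cases D₂ <;> simp_all
  obtain rfl : P₁ = P := eq_of_concat_prefix_of_ne (by simp) (by simp) (by simp) hP hP₁
  obtain rfl : P₂ = P₁ := eq_of_concat_prefix_of_ne (by simp) (hu ▸ by simp) (by simp) hP hP₂
  have hDS : (N :: D₁) ++ S₁ = (N :: D₂) ++ S₂ := by simpa using hu
  obtain rfl : D₁ = D₂ := by
    rcases List.prefix_or_prefix_of_prefix (List.prefix_append _ S₁)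
      (hDS ▸ List.prefix_append _ S₂) with h | h
    · by_contra hne
      exact hfirst₂ _ h (by simp) (by simpa using hne) hret₁
    · by_contra hne
      exact hfirst₁ _ h (by simp) (by simpa [eq_comm] using hne) hret₂
  rw [List.append_cancel_left hDS]

end GridPath

namespace CanopyTree

open BinaryTree GridStep GridPath

/-! ### Right heights along the path of a tree -/

/-- The steps of `u(T)` read on the walk around the left subtree `L` of the root, including the
way back along the left edge. -/
def leftSteps (L : BinaryTree Unit) : GridPath := if L = nil then [] else upperPath L ++ [N]

/-- The steps of `u(T)` read on the walk around the right subtree `R` of the root, including the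
way back along the right edge. -/
def rightSteps (R : BinaryTree Unit) : GridPath := if R = nil then [] else upperPath R ++ [E]

@[simp]
theorem upperPath_nil : upperPath nil = [] := rfl

@[simp]
theorem canopy_nil : canopy nil = [] := rfl

theorem upperPath_node (a : Unit) (L R : BinaryTree Unit) :
    upperPath (node a L R) = leftSteps L ++ rightSteps R := by
  simp only [upperPath, word, leftSteps, rightSteps]
  split_ifs <;> simp

theorem canopy_node (a : Unit) (L R : BinaryTree Unit) : canopy (node a L R) =
    (if L = nil then [] else canopy L ++ [N]) ++ (if R = nil then [] else E :: canopy R) := by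
  simp only [canopy, word]
  split_ifs <;> simp

theorem count_upperPath (T : BinaryTree Unit) (s : GridStep) :
    (upperPath T).count s = (canopy T).count s := by
  induction T with
  | nil => rfl
  | node _ L R ihL ihR =>
    rw [upperPath_node, canopy_node, leftSteps, rightSteps]
    split_ifs <;> simp [ihL, ihR, List.count_cons]

theorem endpoint_upperPath (T : BinaryTree Unit) :
    endpoint (upperPath T) = endpoint (canopy T) := by
  simp [endpoint, count_upperPath]

theorem length_upperPath_add_one {T : BinaryTree Unit} (hT : T ≠ nil) :
    (upperPath T).length + 1 = T.numNodes := by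
  induction T with
  | nil => exact absurd rfl hT
  | node _ L R ihL ihR =>
    rw [upperPath_node, leftSteps, rightSteps]
    split_ifs with hL hR hR
    · simp [hL, hR]
    · simp [hL, ihR hR]
    · simp [hR, ihL hL]
    · simp [← ihL hL, ← ihR hR]
      ring

theorem length_leftSteps (L : BinaryTree Unit) : (leftSteps L).length = L.numNodes := by
  rw [leftSteps]
  split_ifs with hL
  · simp [hL]
  · simp [← length_upperPath_add_one hL]

theorem length_rightSteps (R : BinaryTree Unit) : (rightSteps R).length = R.numNodes := by
  rw [rightSteps]
  split_ifs with hR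
  · simp [hR]
  · simp [← length_upperPath_add_one hR]

theorem length_rightHeightsFrom (d : ℕ) (T : BinaryTree Unit) :
    (rightHeightsFrom d T).length = T.numNodes := by
  induction T generalizing d with
  | nil => rfl
  | node _ L R ihL ihR => simp [rightHeightsFrom, ihL, ihR, add_assoc]

theorem prefix_upperPath_node {L R : BinaryTree Unit} {p : GridPath}
    (hp : p <+: upperPath (node () L R)) :
    p = upperPath (node () L R) ∨ (L ≠ nil ∧ p <+: upperPath L) ∨
      (R ≠ nil ∧ ∃ q, q <+: upperPath R ∧ p = leftSteps L ++ q) := by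
  rw [upperPath_node] at hp ⊢
  have hsplit : (∃ q, q <+: rightSteps R ∧ p = leftSteps L ++ q) ∨
      (L ≠ nil ∧ p <+: upperPath L) := by
    rcases List.prefix_or_prefix_of_prefix hp (List.prefix_append (leftSteps L) _) with h | ⟨q, rfl⟩
    · by_cases hL : L = nil
      · exact .inl ⟨[], by simp, by simpa [leftSteps, hL] using h⟩
      · rw [leftSteps, if_neg hL, List.prefix_concat_iff] at h
        refine h.imp (fun h => ⟨[], by simp, by simp [h, leftSteps, hL]⟩) (⟨hL, ·⟩)
    · exact .inl ⟨q, (List.prefix_append_right_inj _).1 hp, rfl⟩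
  rcases hsplit with ⟨q, hq, rfl⟩ | h
  · by_cases hR : R = nil
    · exact .inl (by simp_all [rightSteps])
    · rw [rightSteps, if_neg hR, List.prefix_concat_iff] at hq
      rcases hq with rfl | hq
      · exact .inl (by simp [rightSteps, hR])
      · exact .inr (.inr ⟨hR, q, hq, rfl⟩)
  · exact .inr (.inl h)

theorem exists_getElem?_rightHeightsFrom {T : BinaryTree Unit} (hT : T ≠ nil) {p : GridPath}
    (hp : p <+: upperPath T) (d : ℕ) :
    ∃ h, (rightHeightsFrom d T)[p.length]? = some (h + d) ∧
      IsHorizDist (canopy T) (endpoint p) h := by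
  induction T generalizing p d with
  | nil => exact absurd rfl hT
  | node _ L R ihL ihR =>
    rcases prefix_upperPath_node hp with rfl | ⟨hL, hp⟩ | ⟨hR, q, hq, rfl⟩
    · refine ⟨0, ?_, endpoint_upperPath (node () L R) ▸ isHorizDist_endpoint _⟩
      have hlen : (upperPath (node () L R)).length =
          (rightHeightsFrom d L ++ rightHeightsFrom (d + 1) R).length := by
        simp [upperPath_node, length_leftSteps, length_rightSteps, length_rightHeightsFrom]
      simp only [rightHeightsFrom, hlen, List.getElem?_concat_length, zero_add]
    · obtain ⟨h, hget, hdist⟩ := ihL hL hp d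
      refine ⟨h, ?_, ?_⟩
      · rw [rightHeightsFrom, List.append_assoc,
          List.getElem?_append_left (List.getElem?_eq_some_iff.1 hget).1, hget]
      · rw [canopy_node, if_neg hL, List.append_assoc]
        exact hdist.append_right (by simp)
    · obtain ⟨h, hget, hdist⟩ := ihR hR hq (d + 1)
      refine ⟨h + 1, ?_, ?_⟩
      · rw [rightHeightsFrom, List.append_assoc, List.length_append, length_leftSteps,
          ← length_rightHeightsFrom d L, List.getElem?_append_right (by simp),
          Nat.add_sub_cancel_left,
          List.getElem?_append_left (List.getElem?_eq_some_iff.1 hget).1, hget]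
        simp only [Option.some.injEq]
        omega
      · have hleft : endpoint (leftSteps L) =
            endpoint (if L = nil then [] else canopy L ++ [N]) := by
          rw [leftSteps]
          split_ifs <;> simp [endpoint_append, endpoint_upperPath]
        rw [canopy_node, if_neg hR, endpoint_append, hleft]
        exact hdist.cons_east.append_left _

theorem HasCanopy.isAbove {v : GridPath} {T : BinaryTree Unit} (h : HasCanopy v T) :
    IsAbove v (upperPath T) := by
  obtain ⟨hT, rfl⟩ := h
  refine ⟨endpoint_upperPath T, ?_⟩
  simp only [points, List.mem_map, List.mem_inits, forall_exists_index, and_imp]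
  rintro _ p hp rfl
  obtain ⟨h, -, hdist⟩ := exists_getElem?_rightHeightsFrom hT hp 0
  exact hdist.pointAbove

theorem HasCanopy.getElem?_rightHeights {v : GridPath} {T : BinaryTree Unit} (h : HasCanopy v T)
    {p : GridPath} (hp : p <+: upperPath T) :
    (rightHeights T)[p.length]? = some (horiz v (endpoint p)) := by
  obtain ⟨hT, rfl⟩ := h
  obtain ⟨h, hget, hdist⟩ := exists_getElem?_rightHeightsFrom hT hp 0
  rw [hdist.horiz_eq]
  exact hget

theorem HasCanopy.rightHeights_eq {v : GridPath} {T : BinaryTree Unit} (h : HasCanopy v T) :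
    rightHeights T = (points (upperPath T)).map (horiz v) := by
  have hlen : (rightHeights T).length = (upperPath T).length + 1 := by
    rw [rightHeights, length_rightHeightsFrom, length_upperPath_add_one h.1]
  refine List.ext_getElem (by simp [points, hlen]) fun i hi _ => ?_
  have hget := h.getElem?_rightHeights (List.take_prefix i (upperPath T))
  rw [List.length_take_of_le (by omega), List.getElem?_eq_getElem hi] at hget
  simpa [points] using hget

/-! ### Reconstruction of a tree from its path -/

theorem le_of_mem_rightHeightsFrom {d x : ℕ} {T : BinaryTree Unit}
    (hx : x ∈ rightHeightsFrom d T) : d ≤ x := by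
  induction T generalizing d with
  | nil => simp [rightHeightsFrom] at hx
  | node _ L R ihL ihR =>
    simp only [rightHeightsFrom, List.mem_append, List.mem_singleton] at hx
    rcases hx with (hx | hx) | rfl
    · exact ihL hx
    · exact (Nat.le_succ d).trans (ihR hx)
    · exact le_rfl

theorem notMem_rightHeightsFrom_succ (d : ℕ) (T : BinaryTree Unit) :
    d ∉ rightHeightsFrom (d + 1) T :=
  fun hd => (le_of_mem_rightHeightsFrom hd).not_gt d.lt_succ_self

theorem exists_cons_rightHeightsFrom_eq_concat (d : ℕ) (T : BinaryTree Unit) :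
    ∃ X, d :: rightHeightsFrom d T = X ++ [d] := by
  cases T with
  | nil => exact ⟨[], rfl⟩
  | node _ L R => exact ⟨_, (List.cons_append ..).symm⟩

theorem rightHeightsFrom_injective (d : ℕ) : Function.Injective (rightHeightsFrom d) := by
  intro T S h
  induction T generalizing d S with
  | nil => cases S <;> simp [rightHeightsFrom] at h ⊢
  | node _ L R ihL ihR =>
    cases S with
    | nil => simp [rightHeightsFrom] at h
    | node _ L' R' =>
      have hsplit : d :: rightHeightsFrom d L ++ rightHeightsFrom (d + 1) R =
          d :: rightHeightsFrom d L' ++ rightHeightsFrom (d + 1) R' :=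
        congrArg (d :: ·) (List.append_cancel_right h)
      obtain ⟨X, hX⟩ := exists_cons_rightHeightsFrom_eq_concat d L
      obtain ⟨X', hX'⟩ := exists_cons_rightHeightsFrom_eq_concat d L'
      rw [hX, hX', List.append_assoc, List.append_assoc] at hsplit
      obtain ⟨rfl, hR⟩ := append_cons_inj_of_notMem_right (notMem_rightHeightsFrom_succ d R)
        (notMem_rightHeightsFrom_succ d R') hsplit
      rw [ihL d (List.cons_injective (hX.trans hX'.symm)), ihR (d + 1) hR]

theorem HasCanopy.upperPath_injective {v : GridPath} {T S : BinaryTree Unit}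
    (hT : HasCanopy v T) (hS : HasCanopy v S) (h : upperPath T = upperPath S) : T = S := by
  refine rightHeightsFrom_injective 0 ?_
  change rightHeights T = rightHeights S
  rw [hT.rightHeights_eq, hS.rightHeights_eq, h]

theorem exists_upperPath_eq_cons_east {T : BinaryTree Unit} (hT : T ≠ nil) :
    ∃ T', HasCanopy (E :: canopy T) T' ∧ upperPath T' = E :: upperPath T := by
  induction T with
  | nil => exact absurd rfl hT
  | node _ L R ihL ihR =>
    by_cases hL : L = nil
    · by_cases hR : R = nil
      · exact ⟨node () nil (node () nil nil), ⟨by simp, by simp [canopy_node, hL, hR]⟩,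
          by simp [upperPath_node, leftSteps, rightSteps, hL, hR]⟩
      · obtain ⟨R', ⟨hR', hcan⟩, hup⟩ := ihR hR
        exact ⟨node () nil R', ⟨by simp, by simp [canopy_node, hL, hR, hR', hcan]⟩,
          by simp [upperPath_node, leftSteps, rightSteps, hL, hR, hR', hup]⟩
    · obtain ⟨L', ⟨hL', hcan⟩, hup⟩ := ihL hL
      exact ⟨node () L' R, ⟨by simp, by simp [canopy_node, hL, hL', hcan]⟩,
        by simp [upperPath_node, leftSteps, hL, hL', hup]⟩

theorem HasCanopy.exists_upperPath_eq_cons_north {k : ℕ} {w : GridPath} {T : BinaryTree Unit}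
    (hT : HasCanopy (List.replicate k E ++ w) T) :
    ∃ T', HasCanopy (List.replicate k E ++ N :: w) T' ∧ upperPath T' = N :: upperPath T := by
  obtain ⟨hT, hw⟩ := hT
  induction T generalizing k w with
  | nil => exact absurd rfl hT
  | node _ L R ihL ihR =>
    by_cases hL : L = nil
    · rw [canopy_node, if_pos hL, List.nil_append] at hw
      cases k with
      | zero =>
        exact ⟨node () (node () nil nil) R,
          ⟨by simp, by simpa [canopy_node] using hw⟩,
          by simp [upperPath_node, leftSteps, rightSteps, hL]⟩
      | succ k =>
        by_cases hR : R = nil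
        · simp [hR, List.replicate_succ] at hw
        · obtain ⟨R', ⟨hR', hcan⟩, hup⟩ := ihR (k := k) (w := w) hR
            (by simpa [hR, List.replicate_succ] using hw)
          exact ⟨node () nil R',
            ⟨by simp, by simp [canopy_node, hR', hcan, List.replicate_succ]⟩,
            by simp [upperPath_node, leftSteps, rightSteps, hL, hR, hR', hup]⟩
    · rw [canopy_node, if_neg hL, List.append_assoc, List.singleton_append] at hw
      obtain ⟨w', hw', rfl⟩ := exists_append_eq_of_replicate_append_eq (by simp) hw.symm
      obtain ⟨L', ⟨hL', hcan⟩, hup⟩ := ihL hL hw'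
      exact ⟨node () L' R, ⟨by simp, by simp [canopy_node, hL', hcan]⟩,
        by simp [upperPath_node, leftSteps, hL, hL', hup]⟩

theorem _root_.GridPath.IsAbove.exists_upperPath_eq {v u : GridPath} (h : IsAbove v u) :
    ∃ T, HasCanopy v T ∧ upperPath T = u := by
  induction u generalizing v with
  | nil =>
    obtain rfl := h.eq_nil
    exact ⟨node () nil nil, ⟨by simp, rfl⟩, rfl⟩
  | cons s u ih =>
    cases s with
    | E =>
      obtain ⟨v', rfl, hu⟩ := h.exists_eq_cons_east
      obtain ⟨T, ⟨hT, rfl⟩, rfl⟩ := ih hu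
      exact exists_upperPath_eq_cons_east hT
    | N =>
      obtain ⟨k, v', rfl, hu⟩ := h.exists_eq_of_cons_north
      obtain ⟨T, hT, rfl⟩ := ih hu
      exact hT.exists_upperPath_eq_cons_north

/-! ### Right rotations along the path of a tree -/

theorem RightRotation.ne_nil {T S : BinaryTree Unit} (h : RightRotation T S) :
    T ≠ nil ∧ S ≠ nil := by
  cases h <;> simp

theorem ValidRightRotation.rightRotation {T S : BinaryTree Unit} (h : ValidRightRotation T S) :
    RightRotation T S := by
  induction h with
  | root A B C _ => exact .root A B C
  | left R _ ih => exact .left R ih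
  | right L _ ih => exact .right L ih

theorem ValidRightRotation.canopy_eq {T S : BinaryTree Unit} (h : ValidRightRotation T S) :
    canopy S = canopy T := by
  induction h with
  | root A B C hB => simp [canopy_node, hB]
  | left R h ih => simp [canopy_node, ih, h.rightRotation.ne_nil]
  | right L h ih => simp [canopy_node, ih, h.rightRotation.ne_nil]

theorem ValidRightRotation.hasCanopy {v : GridPath} {T S : BinaryTree Unit}
    (h : ValidRightRotation T S) (hT : HasCanopy v T) : HasCanopy v S :=
  ⟨h.rightRotation.ne_nil.2, h.canopy_eq.trans hT.2⟩

theorem ValidRightRotation.exists_upperPath_eq {T S : BinaryTree Unit}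
    (h : ValidRightRotation T S) (d : ℕ) :
    ∃ (P Q : GridPath) (C : BinaryTree Unit) (X Y : List ℕ) (c : ℕ),
      upperPath T = P ++ E :: N :: (rightSteps C ++ Q) ∧
      upperPath S = P ++ N :: (rightSteps C ++ E :: Q) ∧
      X.length = P.length + 1 ∧
      rightHeightsFrom d T = X ++ c :: (rightHeightsFrom (c + 1) C ++ c :: Y) := by
  induction h generalizing d with
  | root A B C hB =>
    refine ⟨leftSteps A ++ upperPath B, [], C, rightHeightsFrom d A ++ rightHeightsFrom (d + 1) B,
      [], d, ?_, ?_, ?_, ?_⟩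
    · simp [upperPath_node, leftSteps, rightSteps, hB]
    · simp [upperPath_node, leftSteps, rightSteps, hB]
    · simp [length_leftSteps, length_rightHeightsFrom, ← length_upperPath_add_one hB, add_assoc]
    · simp [rightHeightsFrom]
  | left R h ih =>
    obtain ⟨P, Q, C, X, Y, c, hT, hS, hlen, hheights⟩ := ih d
    refine ⟨P, Q ++ N :: rightSteps R, C, X, Y ++ rightHeightsFrom (d + 1) R ++ [d], c,
      ?_, ?_, hlen, ?_⟩
    · simp [upperPath_node, leftSteps, h.rightRotation.ne_nil, hT]
    · simp [upperPath_node, leftSteps, h.rightRotation.ne_nil, hS]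
    · simp [rightHeightsFrom, hheights]
  | right L h ih =>
    obtain ⟨P, Q, C, X, Y, c, hT, hS, hlen, hheights⟩ := ih (d + 1)
    refine ⟨leftSteps L ++ P, Q ++ [E], C, rightHeightsFrom d L ++ X, Y ++ [d], c, ?_, ?_, ?_, ?_⟩
    · simp [upperPath_node, rightSteps, h.rightRotation.ne_nil, hT]
    · simp [upperPath_node, rightSteps, h.rightRotation.ne_nil, hS]
    · simp [hlen, length_leftSteps, length_rightHeightsFrom, add_assoc]
    · simp [rightHeightsFrom, hheights]

theorem ValidRightRotation.tamStep {v : GridPath} {T S : BinaryTree Unit}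
    (h : ValidRightRotation T S) (hT : HasCanopy v T) : TamStep v (upperPath T) (upperPath S) := by
  obtain ⟨P, Q, C, X, Y, c, hTpath, hSpath, hlen, hheights⟩ := h.exists_upperPath_eq 0
  have horiz_eq : ∀ D', D' <+: N :: rightSteps C →
      some (horiz v (endpoint (P ++ [E] ++ D'))) =
        (c :: (rightHeightsFrom (c + 1) C ++ c :: Y))[D'.length]? := by
    rintro D' ⟨D'', hD⟩
    have hpre : P ++ [E] ++ D' <+: upperPath T :=
      ⟨D'' ++ Q, by simpa [hTpath] using congrArg (· ++ Q) hD⟩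
    rw [← hT.getElem?_rightHeights hpre, rightHeights, hheights,
      List.getElem?_append_right (by simp [hlen])]
    simp [hlen, ← add_assoc]
  have horiz_start : horiz v (endpoint (P ++ [E])) = c := by simpa using horiz_eq [] (by simp)
  refine ⟨P, N :: rightSteps C, Q, by simp [hTpath], by simp [hSpath], rfl, ?_, ?_⟩
  · rw [horiz_start]
    simpa [length_rightSteps, ← length_rightHeightsFrom (c + 1) C] using
      horiz_eq _ List.prefix_rfl
  · intro D' hD' hne hneD
    obtain ⟨i, hi⟩ : ∃ i, D'.length = i + 1 :=
      Nat.exists_eq_succ_of_ne_zero (by simpa using hne)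
    have hiC : i < (rightHeightsFrom (c + 1) C).length := by
      have hlt := hD'.length_le.lt_of_ne (mt hD'.eq_of_length hneD)
      simpa [hi, length_rightSteps, length_rightHeightsFrom] using hlt
    have hmem : horiz v (endpoint (P ++ [E] ++ D')) ∈ rightHeightsFrom (c + 1) C := by
      have hget := horiz_eq D' hD'
      rw [hi, List.getElem?_cons_succ, List.getElem?_append_left hiC] at hget
      exact List.mem_of_getElem? hget.symm
    rw [horiz_start]
    exact (Nat.lt_of_succ_le (le_of_mem_rightHeightsFrom hmem)).ne'

theorem getLast?_leftSteps_ne (L : BinaryTree Unit) : (leftSteps L).getLast? ≠ some E := by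
  rw [leftSteps]
  split_ifs <;> simp

theorem exists_validRightRotation_of_leftSteps_eq {L : BinaryTree Unit} {P : GridPath}
    (h : leftSteps L = P ++ [E, N]) (R : BinaryTree Unit) :
    ∃ S, ValidRightRotation (node () L R) S ∧ P ++ [N] <+: upperPath S := by
  have hL : upperPath L = P ++ [E] := by
    rw [leftSteps] at h
    split_ifs at h
    · simp at h
    · exact List.append_cancel_right (h.trans (by simp))
  cases L with
  | nil => simp at hL
  | node _ A B =>
    rw [upperPath_node] at hL
    by_cases hB : B = nil
    · refine absurd ?_ (getLast?_leftSteps_ne A)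
      simp [show leftSteps A = P ++ [E] by simpa [hB, rightSteps] using hL]
    · have hP : leftSteps A ++ upperPath B = P := by
        rw [rightSteps, if_neg hB, ← List.append_assoc] at hL
        exact List.append_cancel_right hL
      refine ⟨_, .root A B R hB, ?_⟩
      simp [← hP, upperPath_node, leftSteps, rightSteps, hB]

theorem exists_validRightRotation {T : BinaryTree Unit} {P : GridPath}
    (h : P ++ [E, N] <+: upperPath T) :
    ∃ S, ValidRightRotation T S ∧ P ++ [N] <+: upperPath S := by
  induction T generalizing P with
  | nil => simp at h
  | node _ L R ihL ihR =>
    rcases prefix_upperPath_node h with h | ⟨-, h⟩ | ⟨-, q, hq, h⟩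
    · by_cases hR : R = nil
      · refine exists_validRightRotation_of_leftSteps_eq ?_ R
        simpa [upperPath_node, rightSteps, hR] using h.symm
      · have := congrArg List.getLast? h
        simp [upperPath_node, rightSteps, hR] at this
    · obtain ⟨L', hrot, hpre⟩ := ihL h
      refine ⟨_, .left R hrot, hpre.trans ?_⟩
      simp [upperPath_node, leftSteps, hrot.rightRotation.ne_nil]
    · rcases List.eq_nil_or_concat' q with rfl | ⟨q, s, rfl⟩
      · exact exists_validRightRotation_of_leftSteps_eq (by simpa using h.symm) R
      obtain ⟨h, hs⟩ : P ++ [E] = leftSteps L ++ q ∧ [N] = [s] :=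
        List.append_inj' (by simpa using h) rfl
      rcases List.eq_nil_or_concat' q with rfl | ⟨q, t, rfl⟩
      · exact absurd (by simp [← h.trans (List.append_nil _)]) (getLast?_leftSteps_ne L)
      obtain ⟨rfl, ht⟩ : P = leftSteps L ++ q ∧ [E] = [t] :=
        List.append_inj' (by simpa using h) rfl
      obtain ⟨R', hrot, hpre⟩ := ihR (P := q) (by simpa [← hs, ← ht] using hq)
      have hR' : q ++ [N] <+: rightSteps R' := by
        rw [rightSteps, if_neg hrot.rightRotation.ne_nil.2]
        exact hpre.trans (List.prefix_append _ _)
      exact ⟨_, .right L hrot, by simpa [upperPath_node] using hR'⟩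

theorem validRightRotation_iff_tamStep {v : GridPath} {T S : BinaryTree Unit}
    (hT : HasCanopy v T) (hS : HasCanopy v S) :
    ValidRightRotation T S ↔ TamStep v (upperPath T) (upperPath S) := by
  refine ⟨fun h => h.tamStep hT, fun h => ?_⟩
  obtain ⟨P, hPT, hPS⟩ := h.exists_valley
  obtain ⟨S', hrot, hPS'⟩ := exists_validRightRotation hPT
  have hstep := hrot.tamStep hT
  have hPE : P ++ [E] <+: upperPath T := .trans (by simp) hPT
  have hpath := hstep.eq_of_prefix_concat_north h hPE hPS' hPS
  rwa [← (hrot.hasCanopy hT).upperPath_injective hS hpath]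

/-! ### Right rotations are covering relations -/

theorem RightRotation.valid_or_count_lt {T S : BinaryTree Unit} (h : RightRotation T S) :
    ValidRightRotation T S ∨ (canopy S).count N < (canopy T).count N := by
  induction h with
  | root A B C =>
    by_cases hB : B = nil
    · right
      by_cases hA : A = nil <;> by_cases hC : C = nil <;> simp [canopy_node, hA, hB, hC]
    · exact .inl (.root A B C hB)
  | left R h ih =>
    exact ih.imp (.left R) fun ih => by simp [canopy_node, h.ne_nil, ih]
  | right L h ih =>
    exact ih.imp (.right L) fun ih => by simp [canopy_node, h.ne_nil, ih]

theorem TamariLE.count_canopy_le {T S : BinaryTree Unit} (h : TamariLE T S) :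
    (canopy S).count N ≤ (canopy T).count N := by
  induction h with
  | refl => exact le_rfl
  | tail _ h ih =>
    rcases h.valid_or_count_lt with hvalid | hlt
    · rwa [hvalid.canopy_eq]
    · exact hlt.le.trans ih

/-- The sizes of the right subtrees of the vertices of a binary tree, in symmetric order. -/
def rightSizes {α : Type*} : BinaryTree α → List ℕ
  | nil => []
  | node _ L R => rightSizes L ++ R.numNodes :: rightSizes R

theorem length_rightSizes {α : Type*} (T : BinaryTree α) :
    (rightSizes T).length = T.numNodes := by
  induction T with
  | nil => rfl
  | node _ L R ihL ihR => simp [rightSizes, ihL, ihR, add_assoc]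

theorem rightWeight_eq_sum_rightSizes (T : BinaryTree Unit) :
    rightWeight T = (rightSizes T).sum := by
  induction T with
  | nil => rfl
  | node _ L R ihL ihR =>
    simp only [rightWeight, rightSizes, ihL, ihR, List.sum_append, List.sum_cons]
    ring

theorem RightRotation.exists_rightSizes_eq_set {T S : BinaryTree Unit} (h : RightRotation T S) :
    ∃ i b c, (rightSizes T)[i]? = some b ∧ (rightSizes T)[i + b + 1]? = some c ∧
      rightSizes S = (rightSizes T).set i (b + c + 1) := by
  induction h with
  | root A B C =>
    refine ⟨(rightSizes A).length, B.numNodes, C.numNodes, ?_, ?_, ?_⟩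
    · simp [rightSizes]
    · simp [rightSizes, ← length_rightSizes, add_assoc]
    · simp [rightSizes]
  | left R _ ih =>
    obtain ⟨i, b, c, hb, hc, hset⟩ := ih
    have hi := (List.getElem?_eq_some_iff.1 hb).1
    refine ⟨i, b, c, ?_, ?_, ?_⟩
    · rw [rightSizes, List.getElem?_append_left hi, hb]
    · rw [rightSizes, List.getElem?_append_left (List.getElem?_eq_some_iff.1 hc).1, hc]
    · rw [rightSizes, rightSizes, hset, List.set_append_left _ _ hi]
  | right L h ih =>
    obtain ⟨i, b, c, hb, hc, hset⟩ := ih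
    refine ⟨(rightSizes L).length + (i + 1), b, c, ?_, ?_, ?_⟩
    · rw [rightSizes, List.getElem?_append_right (by omega), Nat.add_sub_cancel_left,
        List.getElem?_cons_succ, hb]
    · rw [rightSizes, List.getElem?_append_right (by omega),
        show (rightSizes L).length + (i + 1) + b + 1 - (rightSizes L).length = i + b + 1 + 1 by
          omega, List.getElem?_cons_succ, hc]
    · simp [rightSizes, hset, h.numNodes_eq]

theorem RightRotation.getD_rightSizes_le {T S : BinaryTree Unit} (h : RightRotation T S) (j : ℕ) :
    (rightSizes T).getD j 0 ≤ (rightSizes S).getD j 0 := by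
  obtain ⟨i, b, c, hb, -, hset⟩ := h.exists_rightSizes_eq_set
  rw [hset, List.getD_eq_getElem?_getD, List.getD_eq_getElem?_getD]
  rcases eq_or_ne i j with rfl | hij
  · rw [hb, List.getElem?_set_self (List.getElem?_eq_some_iff.1 hb).1, Option.getD_some,
      Option.getD_some]
    omega
  · rw [List.getElem?_set_ne hij]

theorem TamariLE.getD_rightSizes_le {T S : BinaryTree Unit} (h : TamariLE T S) (j : ℕ) :
    (rightSizes T).getD j 0 ≤ (rightSizes S).getD j 0 := by
  induction h with
  | refl => exact le_rfl
  | tail _ h ih => exact ih.trans (h.getD_rightSizes_le j)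

theorem RightRotation.eq_of_tamariLE {T X Y : BinaryTree Unit} (hX : RightRotation T X)
    (hY : RightRotation T Y) (h : TamariLE X Y) : X = Y := by
  obtain ⟨i, b, c, hb, hc, hXset⟩ := hX.exists_rightSizes_eq_set
  obtain ⟨i', b', c', hb', hc', hYset⟩ := hY.exists_rightSizes_eq_set
  have hindex : i' = i := by
    by_contra hne
    have hle := h.getD_rightSizes_le i
    rw [hXset, hYset, List.getD_eq_getElem?_getD, List.getD_eq_getElem?_getD,
      List.getElem?_set_ne hne, hb, List.getElem?_set_self (List.getElem?_eq_some_iff.1 hb).1,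
      Option.getD_some, Option.getD_some] at hle
    omega
  subst hindex
  obtain rfl : b = b' := Option.some_injective _ (hb.symm.trans hb')
  obtain rfl : c = c' := Option.some_injective _ (hc.symm.trans hc')
  have hweight : rightWeight X = rightWeight Y := by
    rw [rightWeight_eq_sum_rightSizes, rightWeight_eq_sum_rightSizes, hXset, hYset]
  rcases Relation.ReflTransGen.cases_head h with hXY | ⟨Z, hXZ, hZY⟩
  · exact hXY
  · exact absurd (hXZ.rightWeight_lt.trans_le (TamariLE.rightWeight_le hZY)) hweight.not_lt

end CanopyTree

namespace CanopyInterval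

open CanopyTree GridPath

variable {v : GridPath} {T S : CanopyInterval v}

theorem le_iff_reflTransGen :
    T ≤ S ↔
      Relation.ReflTransGen (fun T S : CanopyInterval v => ValidRightRotation T.1 S.1) T S := by
  refine ⟨fun h => ?_, fun h => h.lift Subtype.val fun _ _ h => h.rightRotation⟩
  obtain ⟨T, hT⟩ := T
  change TamariLE T S.1 at h
  induction h using Relation.ReflTransGen.head_induction_on with
  | refl => exact .refl
  | @head T X hTX hXS ih =>
    rcases hTX.valid_or_count_lt with hvalid | hlt
    · exact .head (b := ⟨X, hvalid.hasCanopy hT⟩) hvalid (ih _)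
    · rw [hT.2, ← S.2.2] at hlt
      exact absurd hlt (TamariLE.count_canopy_le hXS).not_gt

theorem lt_of_validRightRotation (h : ValidRightRotation T.1 S.1) : T < S :=
  lt_of_le_of_ne (Relation.ReflTransGen.single h.rightRotation) fun hTS =>
    h.rightRotation.rightWeight_lt.ne (congrArg (rightWeight ·.1) hTS)

theorem exists_validRightRotation_of_lt (h : T < S) :
    ∃ X : CanopyInterval v, ValidRightRotation T.1 X.1 ∧ X ≤ S := by
  rcases Relation.ReflTransGen.cases_head (le_iff_reflTransGen.1 h.le) with hTS | ⟨X, hTX, hXS⟩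
  · exact absurd hTS h.ne
  · exact ⟨X, hTX, le_iff_reflTransGen.2 hXS⟩

theorem covBy_iff : T ⋖ S ↔ ValidRightRotation T.1 S.1 := by
  refine ⟨fun h => ?_, fun h => ⟨lt_of_validRightRotation h, fun W hTW hWS => ?_⟩⟩
  · obtain ⟨X, hTX, hXS⟩ := exists_validRightRotation_of_lt h.lt
    rcases hXS.eq_or_lt with rfl | hlt
    · exact hTX
    · exact absurd hlt (h.2 (lt_of_validRightRotation hTX))
  · obtain ⟨X, hTX, hXW⟩ := exists_validRightRotation_of_lt hTW
    obtain rfl : X = S := Subtype.ext <|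
      hTX.rightRotation.eq_of_tamariLE h.rightRotation (hXW.trans hWS.le)
    exact hXW.not_gt hWS

/-- The bijection `T ↦ u(T)` from `I(v)` to `Tam(v)`. -/
noncomputable def upperPathEquiv (v : GridPath) : CanopyInterval v ≃ Tam v :=
  Equiv.ofBijective (fun T => ⟨upperPath T.1, T.2.isAbove⟩)
    ⟨fun T S h => Subtype.ext (T.2.upperPath_injective S.2 (congrArg Subtype.val h)), fun u =>
      let ⟨T, hT, hu⟩ := u.2.exists_upperPath_eq
      ⟨⟨T, hT⟩, Subtype.ext hu⟩⟩

theorem tamStep_upperPathEquiv_iff :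
    TamStep v (upperPathEquiv v T).1 (upperPathEquiv v S).1 ↔ ValidRightRotation T.1 S.1 :=
  (validRightRotation_iff_tamStep T.2 S.2).symm

/-- The map `T ↦ u(T)` as an isomorphism of posets from `I(v)` to `Tam(v)`. -/
noncomputable def upperPathIso (v : GridPath) : CanopyInterval v ≃o Tam v where
  toEquiv := upperPathEquiv v
  map_rel_iff' := by
    intro T S
    rw [le_iff_reflTransGen]
    constructor <;> intro h
    · rw [← (upperPathEquiv v).symm_apply_apply T, ← (upperPathEquiv v).symm_apply_apply S]
      refine Relation.ReflTransGen.lift (upperPathEquiv v).symm (fun u u' h => ?_) _ _ h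
      refine tamStep_upperPathEquiv_iff.1 ?_
      rwa [Equiv.apply_symm_apply, Equiv.apply_symm_apply]
    · exact h.lift (upperPathEquiv v) fun _ _ => tamStep_upperPathEquiv_iff.2

end CanopyInterval

theorem proposition8 (v : GridPath) :
    ∃ e : CanopyInterval v ≃o Tam v,
      (∀ T : CanopyInterval v, (e T).1 = CanopyTree.upperPath T.1) ∧
      (∀ T : CanopyInterval v, ∀ S : BinaryTree Unit,
        CanopyTree.ValidRightRotation T.1 S ↔
          ∃ hS : CanopyTree.HasCanopy v S,
            GridPath.TamStep v (e T).1 (e ⟨S, hS⟩).1) ∧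
      (∀ u u' : Tam v, u ⋖ u' ↔ GridPath.TamStep v u.1 u'.1) ∧
      (∀ T : CanopyInterval v,
        CanopyTree.rightHeights T.1 =
          (GridPath.points (CanopyTree.upperPath T.1)).map (GridPath.horiz v)) := by
  let e := CanopyInterval.upperPathIso v
  have step_iff (T S : CanopyInterval v) :
      GridPath.TamStep v (e T).1 (e S).1 ↔ CanopyTree.ValidRightRotation T.1 S.1 :=
    CanopyInterval.tamStep_upperPathEquiv_iff
  refine ⟨e, fun _ => rfl, fun T S => ⟨fun h => ?_, fun ⟨hS, h⟩ => ?_⟩, fun u u' => ?_,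
    fun T => T.2.rightHeights_eq⟩
  · exact ⟨h.hasCanopy T.2, (step_iff T ⟨S, h.hasCanopy T.2⟩).2 h⟩
  · exact (step_iff T ⟨S, hS⟩).1 h
  · obtain ⟨T, rfl⟩ := e.surjective u
    obtain ⟨S, rfl⟩ := e.surjective u'
    rw [apply_covBy_apply_iff, CanopyInterval.covBy_iff, step_iff]
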